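/- Let $s\ge 2$ be an integer, $\vartheta>1$ and $b_1,b_2>0$. Let $\mathbb T^+=\{e^{2\pi i\alpha}:\alpha\in(0,\tfrac12)\}$, let $\|x\|_{\mathbb R/\mathbb Z}=\mathrm{dist}(x,\mathbb Z)$ for $x\in\mathbb R$, and let $\|\cdot\|_\infty$ be the sup-norm on $\mathbb C^{2s}$. Let $H=H(s,\vartheta,b_1,b_2)$ be the set of all $\boldsymbol\theta=(\theta_1,\dots,\theta_{2s})\in\mathbb C^{2s}$ such that $|\theta_{2j-1}|=\vartheta$, $\mathrm{Im}(\theta_{2j-1})\ge b_1$ and $\theta_{2j}=\overline{\theta_{2j-1}}$ for $j=1,\dots,s$, and $|\theta_i-\theta_j|\ge b_2$ for all $i\ne j$ in $\{1,\dots,2s\}$. For $\boldsymbol\theta\in H$, $\varepsilon>0$ and $\mathbf z\in\mathbb C^{2s}$ with $z_{2j}=\overline{z_{2j-1}}$ $(1\le j\le s)$ and $\|\mathbf z\|_\infty\ge1$, let $N(\mathbf z)$ be the integer $N\ge 0$ with $\vartheta^{-N}\|\mathbf z\|_\infty\in[1,\vartheta)$, let $\tau_j=\theta_j^{-N(\mathbf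 z)}z_j$ for $1\le j\le 2s$, and let $$\Psi(\boldsymbol\theta,\varepsilon,\mathbf z)=\prod_{n=0}^{N(\mathbf z)}\Bigl(1-2\pi\varepsilon\,\Bigl\|\sum_{j=1}^{2s}\theta_j^n\tau_j\Bigr\|_{\mathbb R/\mathbb Z}^2\Bigr)$$ (the sum is a real number). There is a constant $C_H>0$, depending only on $s,\vartheta,b_1,b_2$, such that for every $\ell\in\{1,\dots,s\}$ and all $\beta,\varepsilon>0$ there is $\gamma_\ell>0$, depending only on $s,\vartheta,b_1,b_2,\ell,\beta,\varepsilon$, with the following property. Fix numbers $\theta'_j\in\mathbb C$ for $j\in\{1,\dots,2s\}\setminus\{2\ell-1,2\ell\}$ that are the corresponding coordinates of some element of $H$. Then there is a set $\mathcal E_\ell\subset\vartheta\cdot\mathbb T^+\subset\mathbb C$ such that (i) $\dim_{\rm H}(\mathcal E_\ell)\le\beta$; (ii) for every $\boldsymbol\theta\in H$ with $\theta_j=\theta'_j$ for all $j\notin\{2\ell-1,2\ell\}$ and $\theta_{2\ell-1}\in\vartheta\cdot\mathbb T^+\setminus\mathcal E_\ell$, there is a constant $R\ge 1$ (which may depend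 on $\boldsymbol\theta$ and on the data fixed above) such that, for every probability vector $\boldsymbol p=(p_0,\dots,p_m)$ with $\min_i p_i\ge\varepsilon$, $$\Psi(\boldsymbol\theta,\varepsilon,\mathbf z)\le C_H\,\|\mathbf z\|_\infty^{-\gamma_\ell}$$ for all $\mathbf z\in\mathbb C^{2s}$ with $z_{2j}=\overline{z_{2j-1}}$ $(1\le j\le s)$ and $|z_{2\ell-1}|=\|\mathbf z\|_\infty\ge R$. -/

import Mathlib

noncomputable section

namespace FourierDecay

/-- The position of the coordinate `2j-1` of a vector `(x_1, …, x_{2s})`, where `j ∈ {1, …, s}`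
is represented by an element of `Fin s` (so both indices are shifted by one). -/
def oddIdx {s : ℕ} (j : Fin s) : Fin (2 * s) := ⟨2 * j.1, by omega⟩

/-- The position of the coordinate `2j` of a vector `(x_1, …, x_{2s})`. -/
def evenIdx {s : ℕ} (j : Fin s) : Fin (2 * s) := ⟨2 * j.1 + 1, by omega⟩

/-- `x_{2j}` is the complex conjugate of `x_{2j-1}` for all `j`; that is, `x = x(ζ)` is the vector
`(ζ_1, conj ζ_1, …, ζ_s, conj ζ_s)` of some `ζ ∈ ℂ^s`. -/
def ConjPaired {s : ℕ} (x : Fin (2 * s) → ℂ) : Prop :=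
  ∀ j : Fin s, x (evenIdx j) = (starRingEnd ℂ) (x (oddIdx j))

/-- The separated set `H(s, ϑ, b₁, b₂) ⊆ ℂ^{2s}`. -/
def H (s : ℕ) (ϑ b₁ b₂ : ℝ) : Set (Fin (2 * s) → ℂ) :=
  {θ | (∀ j : Fin s, ‖θ (oddIdx j)‖ = ϑ ∧ b₁ ≤ (θ (oddIdx j)).im ∧
          θ (evenIdx j) = (starRingEnd ℂ) (θ (oddIdx j))) ∧
        ∀ i j : Fin (2 * s), i ≠ j → b₂ ≤ ‖θ i - θ j‖}

/-- The dilated open upper half circle `ϑ · 𝕋⁺`, `𝕋⁺ = {e^{2πiα} : α ∈ (0, 1/2)}`. -/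
def halfCircle (ϑ : ℝ) : Set ℂ :=
  {w | ∃ α ∈ Set.Ioo (0 : ℝ) (1 / 2), w = ϑ * Complex.exp (2 * Real.pi * Complex.I * α)}

/-- The distance from a real number to the nearest integer, as the norm in `ℝ / ℤ`. -/
def distInt (x : ℝ) : ℝ := ‖(x : UnitAddCircle)‖

/-- The number `N(z)`: for `ϑ > 1` and `‖z‖_∞ ≥ 1`, the integer `N` such that
`ϑ^{-N} ‖z‖_∞ ∈ [1, ϑ)` (see `scale_spec`). The norm on `Fin (2 * s) → ℂ` is the sup-norm. -/
def scale {s : ℕ} (ϑ : ℝ) (z : Fin (2 * s) → ℂ) : ℕ := ⌊Real.logb ϑ ‖z‖⌋₊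

/-- The renormalized vector `τ_j = θ_j^{-N(z)} z_j`. -/
def tau {s : ℕ} (ϑ : ℝ) (θ z : Fin (2 * s) → ℂ) (j : Fin (2 * s)) : ℂ :=
  (θ j ^ scale ϑ z)⁻¹ * z j

/-- The majorant `Ψ(θ, ε, z) = ∏_{n=0}^{N(z)} (1 - 2πε ‖∑_j θ_j^n τ_j‖²_{ℝ/ℤ})`. When `θ` and `z`
are paired by conjugation the sum is a real number (see `sum_im_eq_zero`), so that taking its real
part is only a change of type. -/
def Psi {s : ℕ} (ϑ : ℝ) (θ : Fin (2 * s) → ℂ) (ε : ℝ) (z : Fin (2 * s) → ℂ) : ℝ :=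
  ∏ n ∈ Finset.range (scale ϑ z + 1),
    (1 - 2 * Real.pi * ε * distInt (∑ j, θ j ^ n * tau ϑ θ z j).re ^ 2)

theorem scale_spec {s : ℕ} {ϑ : ℝ} (hϑ : 1 < ϑ) (z : Fin (2 * s) → ℂ) (hz : 1 ≤ ‖z‖) :
    1 ≤ (ϑ ^ scale ϑ z)⁻¹ * ‖z‖ ∧ (ϑ ^ scale ϑ z)⁻¹ * ‖z‖ < ϑ := by
  have h0 : (0 : ℝ) < ϑ := by linarith
  have hp : 0 < ϑ ^ scale ϑ z := pow_pos h0 _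
  have hz0 : 0 < ‖z‖ := by linarith
  have hl : 0 ≤ Real.logb ϑ ‖z‖ := Real.logb_nonneg hϑ hz
  have h1 : ϑ ^ scale ϑ z ≤ ‖z‖ := by
    rw [← Real.rpow_natCast, ← Real.le_logb_iff_rpow_le hϑ hz0]
    exact Nat.floor_le hl
  have h2 : ‖z‖ < ϑ ^ (scale ϑ z + 1) := by
    rw [← Real.rpow_natCast, ← Real.logb_lt_iff_lt_rpow hϑ hz0]
    push_cast
    exact Nat.lt_floor_add_one _
  rw [inv_mul_eq_div, one_le_div hp, div_lt_iff₀ hp]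
  exact ⟨h1, by rw [pow_succ] at h2; linarith⟩

theorem sum_im_eq_zero {s : ℕ} (ϑ : ℝ) (θ z : Fin (2 * s) → ℂ) (hθ : ConjPaired θ)
    (hz : ConjPaired z) (n : ℕ) : (∑ j, θ j ^ n * tau ϑ θ z j).im = 0 := by
  have key : ∀ f : Fin (2 * s) → ℂ, ∑ j, f j = ∑ j : Fin s, (f (oddIdx j) + f (evenIdx j)) := by
    intro f
    rw [← (finProdFinEquiv.trans (finCongr (Nat.mul_comm s 2))).sum_comp, Fintype.sum_prod_type]
    refine Finset.sum_congr rfl fun j _ => ?_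
    rw [Fin.sum_univ_two]
    congr 2
    · ext; simp [oddIdx]
    · ext; simp [evenIdx]; omega
  rw [key, Complex.im_sum]
  refine Finset.sum_eq_zero fun j _ => ?_
  have h : θ (evenIdx j) ^ n * tau ϑ θ z (evenIdx j)
      = (starRingEnd ℂ) (θ (oddIdx j) ^ n * tau ϑ θ z (oddIdx j)) := by
    simp [tau, hθ j, hz j]
  rw [h, Complex.add_im, Complex.conj_im, add_neg_cancel]

end FourierDecay

end

/-!
The proof is an Erdős–Kahane argument. Fix `θ` and `z`, and let `x n` be the sum
`∑ j, θ j ^ n * τ j` in the definition of `Psi`. Let `P` be the polynomial whose roots are the fixed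
coordinates of `θ`, and `S` the shift of sequences. Then `y = P(S) x` is a combination of the `n`-th
powers of `w = θ (oddIdx ℓ)` and its conjugate only, so it satisfies
`y (n + 2) = a * y (n + 1) - b * y n` with `a = 2 * re w` and the known constant `b = ϑ ^ 2`. The
separation in `H` makes `y` grow like `ϑ ^ n`. Replacing `x` by its nearest integers `K`
perturbs the recurrence by a bounded amount only, so `P(S) K` determines `a` up to `O(ϑ ^ (-n))`.
When the distances from `x` to the integers are small near `n`, this estimate of `a` is even good
enough to predict the next term of `K` exactly; otherwise the prediction has a bounded error.

Recording the errors of the predictions thus encodes `K` by a bounded integer vector which is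
nonzero only near the indices `n` where `x n` is far from the integers. If those have a small
proportion among the first `N` indices, there are only `O(ϑ ^ (β * N / 2))` codes, and each of them
confines `w` to a set of diameter `O(ϑ ^ (-N))`. The `w` for which this happens at infinitely many
scales `N` form the exceptional set, which hence has dimension at most `β`. Off this set, a positive
proportion of the factors of `Psi` are at most a constant less than `1`.
-/

noncomputable section

namespace FourierDecay

open Filter Finset MeasureTheory Topology
open scoped ENNReal NNReal Polynomial

/-! ### Hausdorff dimension of limsup sets -/

theorem dimH_le_dimH_image_of_edist_le {X Y : Type*} [EMetricSpace X] [EMetricSpace Y] {f : X → Y}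
    {K : ℝ≥0} {s : Set X} (hf : ∀ x ∈ s, ∀ y ∈ s, edist x y ≤ K * edist (f x) (f y)) :
    dimH s ≤ dimH (f '' s) := by
  have hrestrict : AntilipschitzWith K (s.domRestrict f) := fun x y => hf x x.2 y y.2
  have hisometry : Isometry ((↑) : s → X) := isometry_subtype_coe
  calc dimH s = dimH (Set.univ : Set s) := by
        rw [← hisometry.dimH_image, Set.image_univ, Subtype.range_coe]
    _ ≤ dimH (s.domRestrict f '' Set.univ) := hrestrict.le_dimH_image _
    _ = dimH (f '' s) := by rw [Set.image_univ, Set.range_domRestrict]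

theorem hausdorffMeasure_limsup_eq_zero {X : Type*} [EMetricSpace X] [MeasurableSpace X]
    [BorelSpace X] {ι : ℕ → Type*} [∀ n, Fintype (ι n)] {U : ∀ n, ι n → Set X} {E : Set X}
    (hE : ∀ x ∈ E, ∃ᶠ n in atTop, ∃ i, x ∈ U n i) {β : ℝ} (hβ : 0 ≤ β) {r : ℕ → ℝ≥0∞}
    (hr : Antitone r) (hr₀ : Tendsto r atTop (𝓝 0))
    (hU : ∀ᶠ n in atTop, ∀ i, Metric.ediam (U n i) ≤ r n)
    (hsum : ∑' n, (Fintype.card (ι n) : ℝ≥0∞) * r n ^ β ≠ ∞) :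
    μH[β] E = 0 := by
  obtain ⟨n₀, hn₀⟩ := eventually_atTop.1 hU
  have hcover : ∀ k, E ⊆ ⋃ i : Σ n, ι (n + k), U (i.1 + k) i.2 := fun k x hx => by
    obtain ⟨n, hkn, i, hi⟩ := frequently_atTop.1 (hE x hx) k
    obtain ⟨n, rfl⟩ := Nat.exists_eq_add_of_le' hkn
    exact Set.mem_iUnion.2 ⟨⟨n, i⟩, hi⟩
  have hliminf := Measure.hausdorffMeasure_le_liminf_tsum (ι := fun k => Σ n, ι (n + k)) β E
    (l := atTop) r hr₀ (fun k i => U (i.1 + k) i.2)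
    ((eventually_ge_atTop n₀).mono fun k hk i =>
      (hn₀ _ (hk.trans (Nat.le_add_left _ _)) _).trans (hr (Nat.le_add_left _ _)))
    (Eventually.of_forall hcover)
  have htail : ∀ᶠ k in atTop, ∑' i : (Σ n, ι (n + k)), Metric.ediam (U (i.1 + k) i.2) ^ β
      ≤ ∑' n, (Fintype.card (ι (n + k)) : ℝ≥0∞) * r (n + k) ^ β := by
    filter_upwards [eventually_ge_atTop n₀] with k hk
    rw [ENNReal.tsum_sigma']
    refine ENNReal.tsum_le_tsum fun n => ?_
    rw [tsum_fintype, ← nsmul_eq_mul]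
    exact sum_le_card_nsmul _ _ _ fun i _ =>
      ENNReal.rpow_le_rpow (hn₀ _ (hk.trans (Nat.le_add_left _ _)) i) hβ
  have hlim := tendsto_of_tendsto_of_tendsto_of_le_of_le' tendsto_const_nhds
    (ENNReal.tendsto_sum_nat_add _ hsum) (Eventually.of_forall fun _ => zero_le) htail
  exact le_antisymm (hliminf.trans hlim.liminf_eq.le) zero_le

theorem dimH_limsup_le_of_geometric {X : Type*} [EMetricSpace X] {ι : ℕ → Type*}
    [∀ n, Fintype (ι n)] {U : ∀ n, ι n → Set X} {E : Set X}
    (hE : ∀ x ∈ E, ∃ᶠ n in atTop, ∃ i, x ∈ U n i) {β C K μ r : ℝ} (hβ : 0 ≤ β) (hC : 0 ≤ C)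
    (hμ : 0 ≤ μ) (hr : 0 ≤ r) (hr₁ : r < 1) (hμr : μ * r ^ β < 1)
    (hU : ∀ᶠ n in atTop, ∀ i, Metric.ediam (U n i) ≤ ENNReal.ofReal (C * r ^ n))
    (hcard : ∀ n, (Fintype.card (ι n) : ℝ) ≤ K * μ ^ n) :
    dimH E ≤ ENNReal.ofReal β := by
  borelize X
  have hmono : Antitone fun n : ℕ => ENNReal.ofReal (C * r ^ n) := fun m n hmn =>
    ENNReal.ofReal_le_ofReal
      (mul_le_mul_of_nonneg_left (pow_le_pow_of_le_one hr hr₁.le hmn) hC)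
  have hlim : Tendsto (fun n : ℕ => ENNReal.ofReal (C * r ^ n)) atTop (𝓝 0) := by
    simpa using ENNReal.tendsto_ofReal
      ((tendsto_pow_atTop_nhds_zero_of_lt_one hr hr₁).const_mul C)
  have hsummable : Summable fun n : ℕ => K * C ^ β * (μ * r ^ β) ^ n :=
    (summable_geometric_of_lt_one (by positivity) hμr).mul_left _
  have hterm : ∀ n : ℕ, (Fintype.card (ι n) : ℝ≥0∞) * ENNReal.ofReal (C * r ^ n) ^ β
      ≤ ENNReal.ofReal (K * C ^ β * (μ * r ^ β) ^ n) := fun n => by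
    rw [ENNReal.ofReal_rpow_of_nonneg (by positivity) hβ, ← ENNReal.ofReal_natCast,
      ← ENNReal.ofReal_mul (by positivity), Real.mul_rpow hC (by positivity),
      ← Real.rpow_pow_comm hr]
    refine ENNReal.ofReal_le_ofReal ?_
    calc _ ≤ K * μ ^ n * (C ^ β * (r ^ β) ^ n) := by gcongr; exact hcard n
      _ = _ := by rw [mul_pow]; ring
  refine dimH_le_of_hausdorffMeasure_ne_top (d := β.toNNReal) ?_
  rw [Real.coe_toNNReal β hβ, hausdorffMeasure_limsup_eq_zero hE hβ hmono hlim hU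
    (ne_top_of_le_ne_top hsummable.tsum_ofReal_ne_top (ENNReal.tsum_le_tsum hterm))]
  exact ENNReal.zero_ne_top

/-! ### Counting sparse vectors -/

/-- Integer vectors of length `N` with entries in `[-B, B]`, at most `M` of which are nonzero. -/
def sparseCodes (N B : ℕ) (M : ℝ) : Finset (Fin N → ℤ) :=
  {e ∈ Fintype.piFinset fun _ => Icc (-(B : ℤ)) B | (#{i | e i ≠ 0} : ℝ) ≤ M}

theorem card_sparseCodes_mul_rpow_le (N B : ℕ) (M : ℝ) {t : ℝ} (ht : 0 < t) (ht₁ : t ≤ 1) :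
    (#(sparseCodes N B M) : ℝ) * t ^ M ≤ (1 + 2 * B * t) ^ N := by
  -- Weigh each nonzero entry by `t`: a sparse code has weight at least `t ^ M`.
  let weight : ℤ → ℝ := fun k => if k ≠ 0 then t else 1
  have hweight : ∑ k ∈ Icc (-(B : ℤ)) B, weight k = 1 + 2 * B * t := by
    rw [← add_sum_erase _ _ (a := (0 : ℤ)) (by simp),
      sum_congr rfl (g := fun _ => t) fun k hk => if_pos (mem_erase.1 hk).1, sum_const,
      card_erase_of_mem (by simp), Int.card_Icc,
      show ((B : ℤ) + 1 - -(B : ℤ)).toNat - 1 = 2 * B by omega]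
    simp [weight]
  have hweight_nonneg : ∀ k, 0 ≤ weight k := fun k => by
    simp only [weight]; split_ifs <;> positivity
  have hsparse : ∀ e ∈ sparseCodes N B M, t ^ M ≤ ∏ i, weight (e i) := fun e he => by
    rw [← prod_filter, prod_const, ← Real.rpow_natCast]
    exact Real.rpow_le_rpow_of_exponent_ge ht ht₁ (mem_filter.1 he).2
  calc (#(sparseCodes N B M) : ℝ) * t ^ M ≤ ∑ e ∈ sparseCodes N B M, ∏ i, weight (e i) := by
        rw [← nsmul_eq_mul]; exact card_nsmul_le_sum _ _ _ hsparse
    _ ≤ ∑ e ∈ Fintype.piFinset fun _ : Fin N => Icc (-(B : ℤ)) B, ∏ i, weight (e i) :=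
        sum_le_sum_of_subset_of_nonneg (filter_subset _ _) fun e _ _ =>
          prod_nonneg fun i _ => hweight_nonneg (e i)
    _ = (1 + 2 * B * t) ^ N := by rw [← hweight, sum_pow' _ weight]

theorem exists_card_sparseCodes_le_mul_pow (B : ℕ) (M : ℝ) {μ : ℝ} (hμ : 1 < μ) :
    ∃ κ > 0, ∃ K : ℝ, ∀ n : ℕ, (#(sparseCodes n B (M + κ * n)) : ℝ) ≤ K * μ ^ n := by
  have hsqrt : 0 < √μ - 1 := sub_pos.2 (Real.lt_sqrt_of_sq_lt (by simpa using hμ))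
  obtain ⟨t, ht₀, ht₁, hBt⟩ : ∃ t : ℝ, 0 < t ∧ t < 1 ∧ 1 + 2 * B * t ≤ √μ := by
    refine ⟨min (1 / 2) ((√μ - 1) / (2 * B + 1)), by positivity,
      (min_le_left _ _).trans_lt (by norm_num), ?_⟩
    have hle := min_le_right (1 / 2) ((√μ - 1) / (2 * B + 1))
    rw [le_div_iff₀ (by positivity)] at hle
    have : 0 < min (1 / 2) ((√μ - 1) / (2 * B + 1)) := by positivity
    linarith
  have hlog : Real.log t < 0 := Real.log_neg ht₀ ht₁
  refine ⟨-(Real.log √μ / Real.log t), neg_pos.2 (div_neg_of_pos_of_neg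
    (Real.log_pos (by linarith)) hlog), (t ^ M)⁻¹, fun n => ?_⟩
  -- The proportion `κ` is such that `t ^ (κ * n) = (√μ ^ n)⁻¹`.
  have hsplit : t ^ (M + -(Real.log √μ / Real.log t) * n) = t ^ M * (√μ ^ n)⁻¹ := by
    rw [Real.rpow_add ht₀, Real.rpow_mul ht₀.le, Real.rpow_neg ht₀.le, ← Real.logb,
      Real.rpow_logb ht₀ ht₁.ne (by linarith), Real.rpow_natCast, inv_pow]
  have hcount := (card_sparseCodes_mul_rpow_le n B (M + -(Real.log √μ / Real.log t) * n) ht₀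
    ht₁.le).trans (pow_le_pow_left₀ (by positivity) hBt n)
  rw [hsplit, ← mul_assoc, ← div_eq_mul_inv, div_le_iff₀ (by positivity), ← mul_pow,
    Real.mul_self_sqrt (by linarith), mul_comm, ← le_inv_mul_iff₀ (by positivity)] at hcount
  rwa [mul_comm] at hcount ⊢

/-! ### Recurrences and prediction -/

/-- `P(S) x`, where `S` is the shift `(S x) n = x (n + 1)` on sequences. -/
def shiftEval {R : Type*} [Semiring R] (P : R[X]) (x : ℕ → R) (n : ℕ) : R :=
  ∑ i ∈ range (P.natDegree + 1), P.coeff i * x (n + i)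

theorem shiftEval_congr {R : Type*} [Semiring R] {P : R[X]} {x y : ℕ → R} {n : ℕ}
    (h : ∀ i ≤ n + P.natDegree, x i = y i) : shiftEval P x n = shiftEval P y n :=
  sum_congr rfl fun i hi => by
    rw [h (n + i) (Nat.add_le_add_left (Nat.lt_succ_iff.1 (mem_range.1 hi)) n)]

theorem shiftEval_sum_pow {R ι : Type*} [CommSemiring R] [Fintype ι] (P : R[X]) (θ τ : ι → R)
    (n : ℕ) :
    shiftEval P (fun n => ∑ j, θ j ^ n * τ j) n = ∑ j, θ j ^ n * (τ j * P.eval (θ j)) := by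
  simp only [shiftEval, Polynomial.eval_eq_sum_range, mul_sum]
  rw [sum_comm]
  exact sum_congr rfl fun j _ => sum_congr rfl fun i _ => by rw [pow_add]; ring

theorem norm_shiftEval_sub_le {R : Type*} [SeminormedRing R] {P : R[X]} {x y : ℕ → R} {n : ℕ}
    {δ : ℝ} (h : ∀ i ≤ P.natDegree, ‖x (n + i) - y (n + i)‖ ≤ δ) :
    ‖shiftEval P x n - shiftEval P y n‖ ≤ (∑ i ∈ range (P.natDegree + 1), ‖P.coeff i‖) * δ := by
  rw [shiftEval, shiftEval, ← sum_sub_distrib, sum_mul]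
  refine norm_sum_le_of_le _ fun i hi => ?_
  rw [← mul_sub]
  exact norm_mul_le_of_le le_rfl (h i (Nat.lt_succ_iff.1 (mem_range.1 hi)))

/-- The defect of a sequence `y` in the recurrence `y (n + 2) = a * y (n + 1) - b * y n`. -/
def defect {R : Type*} [Ring R] (a b : R) (y : ℕ → R) (n : ℕ) : R :=
  y (n + 2) - a * y (n + 1) + b * y n

theorem norm_defect_le {R : Type*} [SeminormedRing R] {a b : R} {A η : ℝ}
    (hA : 1 + ‖a‖ + ‖b‖ ≤ A) {y Y : ℕ → R} {n : ℕ} (hy : defect a b y n = 0)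
    (h : ∀ i ≤ 2, ‖Y (n + i) - y (n + i)‖ ≤ η) : ‖defect a b Y n‖ ≤ A * η := by
  have hη : 0 ≤ η := (norm_nonneg _).trans (h 0 zero_le_two)
  have hdiff : defect a b Y n = (Y (n + 2) - y (n + 2)) - a * (Y (n + 1) - y (n + 1))
      + b * (Y (n + 0) - y (n + 0)) := by
    rw [← sub_zero (defect a b Y n), ← hy]
    simp only [defect, add_zero, mul_sub]
    abel
  calc ‖defect a b Y n‖ ≤ η + ‖a‖ * η + ‖b‖ * η := by
        rw [hdiff]
        exact norm_add_le_of_le (norm_sub_le_of_le (h 2 le_rfl)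
          (norm_mul_le_of_le le_rfl (h 1 one_le_two))) (norm_mul_le_of_le le_rfl (h 0 zero_le_two))
    _ = (1 + ‖a‖ + ‖b‖) * η := by ring
    _ ≤ A * η := mul_le_mul_of_nonneg_right hA hη

/-- The least squares estimate, from `Y m, …, Y (m + 3)`, of the parameter `a` of the recurrence
`Y (n + 2) = a * Y (n + 1) - b * Y n`. -/
def estimate (b : ℂ) (Y : ℕ → ℂ) (m : ℕ) : ℂ :=
  ((starRingEnd ℂ) (Y (m + 1)) * (Y (m + 2) + b * Y m)
    + (starRingEnd ℂ) (Y (m + 2)) * (Y (m + 3) + b * Y (m + 1)))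
    / ((‖Y (m + 1)‖ ^ 2 + ‖Y (m + 2)‖ ^ 2 : ℝ) : ℂ)

section Estimate

variable {a b : ℂ} {r A : ℝ} {Y : ℕ → ℂ} {m : ℕ}

variable (a b Y m) in
theorem estimate_sub_mul :
    (estimate b Y m - a) * ((‖Y (m + 1)‖ ^ 2 + ‖Y (m + 2)‖ ^ 2 : ℝ) : ℂ)
      = (starRingEnd ℂ) (Y (m + 1)) * defect a b Y m
        + (starRingEnd ℂ) (Y (m + 2)) * defect a b Y (m + 1) := by
  have hzero : ((‖Y (m + 1)‖ ^ 2 + ‖Y (m + 2)‖ ^ 2 : ℝ) : ℂ) = 0 →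
      Y (m + 1) = 0 ∧ Y (m + 2) = 0 := fun h => by
    rw [Complex.ofReal_eq_zero, add_eq_zero_iff_of_nonneg (by positivity) (by positivity)] at h
    simpa using h
  rw [sub_mul, estimate, div_mul_cancel_of_imp fun h => by simp [hzero h]]
  push_cast
  rw [← Complex.conj_mul', ← Complex.conj_mul']
  simp only [defect, add_assoc, Nat.reduceAdd]
  ring

theorem norm_estimate_sub_mul_le (h₀ : ‖defect a b Y m‖ ≤ r) (h₁ : ‖defect a b Y (m + 1)‖ ≤ r) :
    ‖estimate b Y m - a‖ * (‖Y (m + 1)‖ + ‖Y (m + 2)‖) ≤ 2 * r := by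
  set u := ‖Y (m + 1)‖
  set v := ‖Y (m + 2)‖
  have hr : 0 ≤ r := (norm_nonneg _).trans h₀
  have hnormal : ‖estimate b Y m - a‖ * (u ^ 2 + v ^ 2) ≤ u * r + v * r := by
    have := congrArg norm (estimate_sub_mul a b Y m)
    rw [norm_mul, Complex.norm_real, Real.norm_of_nonneg (by positivity)] at this
    rw [this]
    exact norm_add_le_of_le (norm_mul_le_of_le (RCLike.norm_conj _).le h₀)
      (norm_mul_le_of_le (RCLike.norm_conj _).le h₁)
  have hsq : (u + v) ^ 2 ≤ 2 * (u ^ 2 + v ^ 2) := add_sq_le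
  rcases (by positivity : 0 ≤ u + v).eq_or_lt with h | h
  · rw [← h]; linarith
  · refine le_of_mul_le_mul_right ?_ h
    calc _ = ‖estimate b Y m - a‖ * (u + v) ^ 2 := by ring
      _ ≤ ‖estimate b Y m - a‖ * (2 * (u ^ 2 + v ^ 2)) := by gcongr
      _ ≤ 2 * r * (u + v) := by linarith

theorem norm_le_mul_of_norm_defect_le (hA : 1 + ‖a‖ + ‖b‖ ≤ A) (hS : 1 ≤ ‖Y m‖ + ‖Y (m + 1)‖)
    (h : ‖defect a b Y m‖ ≤ r) : ‖Y (m + 2)‖ ≤ (A + r) * (‖Y m‖ + ‖Y (m + 1)‖) := by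
  set S := ‖Y m‖ + ‖Y (m + 1)‖ with hSd
  have hr : 0 ≤ r := (norm_nonneg _).trans h
  calc ‖Y (m + 2)‖ = ‖defect a b Y m + a * Y (m + 1) - b * Y m‖ := by
        congr 1; simp only [defect]; ring
    _ ≤ r + ‖a‖ * S + ‖b‖ * S :=
        norm_sub_le_of_le (norm_add_le_of_le h (norm_mul_le_of_le le_rfl (by simp [hSd])))
          (norm_mul_le_of_le le_rfl (by simp [hSd]))
    _ ≤ (r + ‖a‖ + ‖b‖) * S := by linarith [le_mul_of_one_le_right hr hS]
    _ ≤ (A + r) * S := mul_le_mul_of_nonneg_right (by linarith) (by positivity)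

theorem norm_estimate_mul_sub_le (hA : 1 + ‖a‖ + ‖b‖ ≤ A)
    (hS : 1 ≤ ‖Y (m + 1)‖ + ‖Y (m + 2)‖) (h : ∀ i ≤ 2, ‖defect a b Y (m + i)‖ ≤ r) :
    ‖estimate b Y m * Y (m + 3) - b * Y (m + 2) - Y (m + 4)‖ ≤ r * (1 + 2 * A + 2 * r) := by
  set S := ‖Y (m + 1)‖ + ‖Y (m + 2)‖
  have hr : 0 ≤ r := (norm_nonneg _).trans (h 2 le_rfl)
  have hA₀ : 0 ≤ A := le_trans (by positivity) hA
  have hestimate : ‖estimate b Y m - a‖ * S ≤ 2 * r :=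
    norm_estimate_sub_mul_le (h 0 zero_le_two) (h 1 one_le_two)
  have hgrowth : ‖Y (m + 3)‖ ≤ (A + r) * S :=
    norm_le_mul_of_norm_defect_le hA hS (h 1 one_le_two)
  -- The error of the estimate is inversely proportional to `S`, which makes up for the factor
  -- `Y (m + 3)`.
  calc _ = ‖(estimate b Y m - a) * Y (m + 3) - defect a b Y (m + 2)‖ := by
        congr 1; simp only [defect, add_assoc, Nat.reduceAdd]; ring
    _ ≤ ‖estimate b Y m - a‖ * ((A + r) * S) + r :=
        norm_sub_le_of_le (norm_mul_le_of_le le_rfl hgrowth) (h 2 le_rfl)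
    _ = (‖estimate b Y m - a‖ * S) * (A + r) + r := by ring
    _ ≤ 2 * r * (A + r) + r := by gcongr
    _ = r * (1 + 2 * A + 2 * r) := by ring

theorem estimate_shiftEval_congr {P : ℂ[X]} {x y : ℕ → ℂ}
    (h : ∀ i ≤ m + 3 + P.natDegree, x i = y i) :
    estimate b (shiftEval P x) m = estimate b (shiftEval P y) m := by
  have hcongr : ∀ j ≤ 3, shiftEval P x (m + j) = shiftEval P y (m + j) := fun j hj =>
    shiftEval_congr fun i hi => h i (by omega)
  rw [estimate, estimate, ← add_zero m, hcongr 0 (by norm_num), add_zero, hcongr 1 (by norm_num),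
    hcongr 2 (by norm_num), hcongr 3 le_rfl]

end Estimate

section Code

variable {b : ℂ} {P : ℂ[X]} {K K' : ℕ → ℤ}

/-- For a monic polynomial `P` of degree `d` and an integer sequence `K` such that `P(S) K`
approximately satisfies a recurrence `y (n + 2) = a * y (n + 1) - b * y n` with unknown `a`, the
prediction of `K (m + 4 + d)` from the `d + 4` terms `K m, …, K (m + 3 + d)`. -/
def predict (b : ℂ) (P : ℂ[X]) (K : ℕ → ℤ) (m : ℕ) : ℤ :=
  round (estimate b (shiftEval P fun n => K n) m * shiftEval P (fun n => K n) (m + 3)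
    - b * shiftEval P (fun n => K n) (m + 2)
    - ∑ i ∈ range P.natDegree, P.coeff i * (K (m + 4 + i) : ℂ)).re

theorem predict_congr {m : ℕ} (h : ∀ i < m + 4 + P.natDegree, K i = K' i) :
    predict b P K m = predict b P K' m := by
  have hcast : ∀ i ≤ m + 3 + P.natDegree, (K i : ℂ) = K' i := fun i hi => by rw [h i (by omega)]
  rw [predict, predict, estimate_shiftEval_congr hcast, shiftEval_congr (n := m + 3) hcast,
    shiftEval_congr (n := m + 2) fun i hi => hcast i (by omega),
    sum_congr rfl fun i hi => by rw [h (m + 4 + i) (by have := mem_range.1 hi; omega)]]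

/-- The deviation of an integer sequence from its prediction, in which the first `L + deg P + 4`
terms are recorded as they are. -/
def code (b : ℂ) (P : ℂ[X]) (L : ℕ) (K : ℕ → ℤ) (n : ℕ) : ℤ :=
  if n < L + P.natDegree + 4 then K n else K n - predict b P K (n - (P.natDegree + 4))

theorem eq_of_code_eq {L N : ℕ} (h : ∀ n ≤ N, code b P L K n = code b P L K' n) :
    ∀ n ≤ N, K n = K' n := by
  intro n
  induction n using Nat.strong_induction_on with
  | _ n ih =>
    intro hn
    have hcode := h n hn
    unfold code at hcode
    split_ifs at hcode
    · exact hcode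
    · rwa [predict_congr fun i hi => ih i (by omega) (by omega), sub_left_inj] at hcode

end Code

theorem distInt_eq (x : ℝ) : distInt x = |x - round x| := UnitAddCircle.norm_eq

theorem distInt_nonneg (x : ℝ) : 0 ≤ distInt x := norm_nonneg _

theorem distInt_le_half (x : ℝ) : distInt x ≤ 1 / 2 := by
  rw [distInt_eq]; exact abs_sub_round x

theorem norm_round_sub (x : ℝ) : ‖((round x : ℤ) : ℂ) - (x : ℂ)‖ = distInt x := by
  rw [distInt_eq, abs_sub_comm, ← Real.norm_eq_abs, ← Complex.norm_real]; push_cast; rfl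

/-! ### Traces -/

/-- The indices `n < N` at which `x n` is at distance more than `ρ` from the integers. -/
def farIndices (ρ : ℝ) (x : ℕ → ℝ) (N : ℕ) : Finset ℕ :=
  {n ∈ range N | ρ < distInt (x n)}

/-- Constants controlling a family of traces (see `IsTrace`): a growth rate `ϑ`, bounds `A` and `Q`
for the coefficients of the recurrence and of the polynomial, and the constants `c` and `D` of the
lower and upper growth bounds. -/
structure TraceBounds where
  (ϑ A Q c D : ℝ)
  one_lt_ϑ : 1 < ϑ
  one_le_A : 1 ≤ A
  one_le_Q : 1 ≤ Q
  c_pos : 0 < c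
  D_nonneg : 0 ≤ D

namespace TraceBounds

variable (T : TraceBounds)

/-- The factor by which `predict` amplifies the distances to the nearest integers. -/
def gain : ℝ := T.A * T.Q * (1 + 2 * T.A + T.A * T.Q)

/-- A distance to the nearest integers that `predict` amplifies to at most `1 / 4`. -/
def threshold : ℝ := (4 * T.gain)⁻¹

theorem one_le_gain : 1 ≤ T.gain := by
  have hA := T.one_le_A
  have hAQ : 1 ≤ T.A * T.Q := one_le_mul_of_one_le_of_one_le hA T.one_le_Q
  exact one_le_mul_of_one_le_of_one_le hAQ (by linarith)

theorem threshold_pos : 0 < T.threshold := by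
  have := T.one_le_gain
  rw [threshold]; positivity

theorem gain_mul_threshold : T.gain * T.threshold = 1 / 4 := by
  have := T.one_le_gain
  rw [threshold]; field_simp

theorem threshold_le_half : T.threshold ≤ 1 / 2 := by
  have := le_mul_of_one_le_left T.threshold_pos.le T.one_le_gain
  linarith [T.gain_mul_threshold]

theorem exists_two_mul_Q_le : ∃ L : ℕ, 2 * T.Q ≤ T.c * T.ϑ ^ L := by
  obtain ⟨L, hL⟩ := pow_unbounded_of_one_lt (2 * T.Q / T.c) T.one_lt_ϑ
  exact ⟨L, ((div_lt_iff₀' T.c_pos).1 hL).le⟩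

open Classical in
/-- The first index from which on rounding errors do not spoil the lower growth bound. -/
def burnIn : ℕ := Nat.find T.exists_two_mul_Q_le

variable {T} in
theorem two_mul_Q_le {m : ℕ} (hm : T.burnIn ≤ m) : 2 * T.Q ≤ T.c * T.ϑ ^ m := by
  classical
  exact (Nat.find_spec T.exists_two_mul_Q_le).trans
    (mul_le_mul_of_nonneg_left (pow_le_pow_right₀ T.one_lt_ϑ.le hm) T.c_pos.le)

/-- A bound for the code of the nearest integers of a trace when `deg P = d`. -/
def codeBound (d : ℕ) : ℕ := ⌈T.gain + T.D * T.ϑ ^ (T.burnIn + d + 4) + 1⌉₊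

end TraceBounds

/-- `x` is a real sequence of growth rate `ϑ` which the monic polynomial `P` in the shift turns into
a solution of the recurrence `y (n + 2) = a * y (n + 1) - b * y n`, with constants bounded by
`T`. -/
structure IsTrace (T : TraceBounds) (P : ℂ[X]) (b a : ℂ) (x : ℕ → ℝ) : Prop where
  monic : P.Monic
  sum_norm_coeff_le : ∑ i ∈ range (P.natDegree + 1), ‖P.coeff i‖ ≤ T.Q
  norm_add_le : 1 + ‖a‖ + ‖b‖ ≤ T.A
  recurrence : ∀ n, defect a b (shiftEval P fun n => x n) n = 0
  lower : ∀ n, T.c * T.ϑ ^ n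
    ≤ ‖shiftEval P (fun n => x n) (n + 1)‖ + ‖shiftEval P (fun n => x n) (n + 2)‖
  upper : ∀ n, |x n| ≤ T.D * T.ϑ ^ n

namespace IsTrace

variable {T : TraceBounds} {P : ℂ[X]} {a b : ℂ} {x : ℕ → ℝ} {m n : ℕ} {δ : ℝ}

theorem norm_shiftEval_round_sub_le (h : IsTrace T P b a x)
    (hδ : ∀ i ≤ P.natDegree, distInt (x (n + i)) ≤ δ) :
    ‖shiftEval P (fun n => (round (x n) : ℤ)) n - shiftEval P (fun n => x n) n‖ ≤ T.Q * δ :=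
  (norm_shiftEval_sub_le fun i hi => (norm_round_sub _).trans_le (hδ i hi)).trans
    (mul_le_mul_of_nonneg_right h.sum_norm_coeff_le
      ((distInt_nonneg _).trans (hδ 0 (Nat.zero_le _))))

theorem norm_defect_round_le (h : IsTrace T P b a x)
    (hδ : ∀ i ≤ P.natDegree + 2, distInt (x (n + i)) ≤ δ) :
    ‖defect a b (shiftEval P fun n => (round (x n) : ℤ)) n‖ ≤ T.A * (T.Q * δ) :=
  norm_defect_le h.norm_add_le (h.recurrence n) fun j hj =>
    h.norm_shiftEval_round_sub_le fun i hi => by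
      rw [add_assoc]; exact hδ _ (by omega)

theorem lower_round (h : IsTrace T P b a x) (hm : T.burnIn ≤ m) :
    T.c / 2 * T.ϑ ^ m ≤ ‖shiftEval P (fun n => (round (x n) : ℤ)) (m + 1)‖
      + ‖shiftEval P (fun n => (round (x n) : ℤ)) (m + 2)‖ := by
  have hclose : ∀ k, ‖shiftEval P (fun n => x n) k‖
      - ‖shiftEval P (fun n => (round (x n) : ℤ)) k‖ ≤ T.Q * (1 / 2) := fun k => by
    refine (norm_sub_norm_le _ _).trans ?_
    rw [norm_sub_rev]
    exact h.norm_shiftEval_round_sub_le fun i _ => distInt_le_half _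
  linarith [hclose (m + 1), hclose (m + 2), h.lower m, T.two_mul_Q_le hm]

theorem norm_estimate_sub_mul_le (h : IsTrace T P b a x) (hm : T.burnIn ≤ m) :
    ‖estimate b (shiftEval P fun n => (round (x n) : ℤ)) m - a‖ * (T.c / 2 * T.ϑ ^ m)
      ≤ T.A * T.Q :=
  calc _ ≤ _ := mul_le_mul_of_nonneg_left (h.lower_round hm) (norm_nonneg _)
    _ ≤ 2 * (T.A * (T.Q * (1 / 2))) := FourierDecay.norm_estimate_sub_mul_le
        (h.norm_defect_round_le fun i _ => distInt_le_half _)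
        (h.norm_defect_round_le fun i _ => distInt_le_half _)
    _ = T.A * T.Q := by ring

theorem exists_predict_eq_round (h : IsTrace T P b a x) (hm : T.burnIn ≤ m) (hδ₁ : δ ≤ 1 / 2)
    (hδ : ∀ i ≤ P.natDegree + 4, distInt (x (m + i)) ≤ δ) :
    ∃ p : ℝ, predict b P (fun n => round (x n)) m = round p ∧
      |p - round (x (m + 4 + P.natDegree))| ≤ T.gain * δ := by
  refine ⟨_, rfl, ?_⟩
  set Y := shiftEval P (fun n => ((round (x n) : ℤ) : ℂ)) with hY
  have hA := T.one_le_A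
  have hQ := T.one_le_Q
  have hδ₀ : 0 ≤ δ := (distInt_nonneg _).trans (hδ 0 (Nat.zero_le _))
  have hlower : 1 ≤ ‖Y (m + 1)‖ + ‖Y (m + 2)‖ := by
    linarith [h.lower_round hm, T.two_mul_Q_le hm]
  have hpredict := norm_estimate_mul_sub_le h.norm_add_le hlower fun j hj =>
    h.norm_defect_round_le fun i hi => by rw [add_assoc]; exact hδ _ (by omega)
  have hlast : Y (m + 4) = ∑ i ∈ range P.natDegree, P.coeff i * ((round (x (m + 4 + i)) : ℤ) : ℂ)
      + ((round (x (m + 4 + P.natDegree)) : ℤ) : ℂ) := by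
    rw [hY, shiftEval, sum_range_succ, h.monic.coeff_natDegree, one_mul]
  rw [hlast, ← sub_sub] at hpredict
  rw [← Complex.intCast_re, ← Complex.sub_re]
  calc _ ≤ T.A * (T.Q * δ) * (1 + 2 * T.A + 2 * (T.A * (T.Q * δ))) :=
        (Complex.abs_re_le_norm _).trans hpredict
    _ ≤ T.A * (T.Q * δ) * (1 + 2 * T.A + 2 * (T.A * (T.Q * (1 / 2)))) := by gcongr
    _ = T.gain * δ := by rw [TraceBounds.gain]; ring

theorem code_eq_zero (h : IsTrace T P b a x) (hn : T.burnIn + P.natDegree + 4 ≤ n)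
    (hρ : ∀ i ≤ P.natDegree + 4, distInt (x (n - i)) ≤ T.threshold) :
    code b P T.burnIn (fun n => round (x n)) n = 0 := by
  obtain ⟨m, rfl⟩ : ∃ m, n = m + 4 + P.natDegree := ⟨n - (P.natDegree + 4), by omega⟩
  obtain ⟨p, hp, hpx⟩ := h.exists_predict_eq_round (m := m) (by omega) T.threshold_le_half
    fun i hi => by
      have := hρ (P.natDegree + 4 - i) (by omega)
      rwa [show m + 4 + P.natDegree - (P.natDegree + 4 - i) = m + i by omega] at this
  rw [T.gain_mul_threshold, abs_le] at hpx
  rw [code, if_neg (by omega), show m + 4 + P.natDegree - (P.natDegree + 4) = m by omega, hp,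
    sub_eq_zero, eq_comm, round_eq_iff]
  constructor <;> linarith

theorem abs_code_le (h : IsTrace T P b a x) (n : ℕ) :
    |code b P T.burnIn (fun n => round (x n)) n| ≤ T.codeBound P.natDegree := by
  have hgain := T.one_le_gain
  have hD := T.D_nonneg
  have hϑ := T.one_lt_ϑ
  have hDϑ : 0 ≤ T.D * T.ϑ ^ (T.burnIn + P.natDegree + 4) := by positivity
  suffices |(code b P T.burnIn (fun n => round (x n)) n : ℝ)|
      ≤ T.gain + T.D * T.ϑ ^ (T.burnIn + P.natDegree + 4) + 1 by
    exact_mod_cast this.trans (Nat.le_ceil _)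
  rw [code]
  split_ifs with hn
  · have hupper : |x n| ≤ T.D * T.ϑ ^ (T.burnIn + P.natDegree + 4) := (h.upper n).trans
      (mul_le_mul_of_nonneg_left (pow_le_pow_right₀ hϑ.le hn.le) hD)
    have hround := abs_sub_round (x n)
    rw [abs_le] at hupper hround ⊢
    constructor <;> linarith
  · obtain ⟨m, rfl⟩ : ∃ m, n = m + 4 + P.natDegree := ⟨n - (P.natDegree + 4), by omega⟩
    obtain ⟨p, hp, hpx⟩ := h.exists_predict_eq_round (m := m) (by omega) le_rfl
      fun i _ => distInt_le_half _
    have hround := abs_sub_round p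
    rw [show m + 4 + P.natDegree - (P.natDegree + 4) = m by omega, hp, Int.cast_sub]
    rw [abs_le] at hpx hround ⊢
    constructor <;> linarith

theorem card_code_ne_zero_le (h : IsTrace T P b a x) (N : ℕ) :
    #{i : Fin N | code b P T.burnIn (fun n => round (x n)) i ≠ 0}
      ≤ (T.burnIn + P.natDegree + 4)
        + (P.natDegree + 5) * #(farIndices T.threshold x N) := by
  set F := farIndices T.threshold x N with hF
  set near := (range (P.natDegree + 5)).biUnion fun j => F.image (· + j) with hnear
  have hsupport : ∀ i : Fin N, code b P T.burnIn (fun n => round (x n)) i ≠ 0 →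
      (i : ℕ) ∈ range (T.burnIn + P.natDegree + 4) ∪ near := by
    intro i hi
    by_contra hcon
    simp only [hnear, mem_union, mem_range, mem_biUnion, mem_image, not_or, not_lt, not_exists,
      not_and] at hcon
    refine hi (h.code_eq_zero hcon.1 fun j hj => not_lt.1 fun hlt => ?_)
    refine hcon.2 j (by omega) (i - j) ?_ (by omega)
    rw [hF, farIndices, mem_filter, mem_range]
    exact ⟨by omega, hlt⟩
  calc _ ≤ #(range (T.burnIn + P.natDegree + 4) ∪ near) :=
        card_le_card_of_injOn (fun i : Fin N => (i : ℕ))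
          (fun i hi => hsupport i (by simpa using hi)) Fin.val_injective.injOn
    _ ≤ (T.burnIn + P.natDegree + 4) + #near :=
        (card_union_le _ _).trans_eq (by rw [card_range])
    _ ≤ _ := by
        gcongr
        exact (card_biUnion_le_card_mul _ _ #F fun j _ => card_image_le).trans_eq
          (by rw [card_range])

theorem code_mem_sparseCodes (h : IsTrace T P b a x) {N : ℕ} {M : ℝ}
    (hM : (#(farIndices T.threshold x N) : ℝ) ≤ M) :
    (fun i : Fin N => code b P T.burnIn (fun n => round (x n)) i)
      ∈ sparseCodes N (T.codeBound P.natDegree)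
          (T.burnIn + P.natDegree + 4 + (P.natDegree + 5) * M) := by
  rw [sparseCodes, mem_filter, Fintype.mem_piFinset]
  refine ⟨fun i => mem_Icc.2 (abs_le.1 (h.abs_code_le i)), ?_⟩
  calc _ ≤ (((T.burnIn + P.natDegree + 4)
        + (P.natDegree + 5) * #(farIndices T.threshold x N) : ℕ) : ℝ) :=
        Nat.cast_le.2 (h.card_code_ne_zero_le N)
    _ ≤ _ := by push_cast; gcongr

theorem norm_param_sub_mul_le (h : IsTrace T P b a x) {a' : ℂ} {x' : ℕ → ℝ}
    (h' : IsTrace T P b a' x') (hm : T.burnIn ≤ m) {L : ℕ}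
    (hcode : ∀ n ≤ m + 3 + P.natDegree, code b P L (fun n => round (x n)) n
      = code b P L (fun n => round (x' n)) n) :
    ‖a - a'‖ * (T.c / 2 * T.ϑ ^ m) ≤ 2 * (T.A * T.Q) := by
  have hround := eq_of_code_eq hcode
  have hleft := h.norm_estimate_sub_mul_le hm
  rw [estimate_shiftEval_congr (y := fun n => ((round (x' n) : ℤ) : ℂ))
    fun i hi => by exact_mod_cast hround i hi, norm_sub_rev] at hleft
  have hpos : 0 ≤ T.c / 2 * T.ϑ ^ m := by linarith [T.two_mul_Q_le hm, T.one_le_Q]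
  have htriangle := mul_le_mul_of_nonneg_right (norm_sub_le_norm_sub_add_norm_sub a
    (estimate b (shiftEval P fun n => (round (x' n) : ℤ)) m) a') hpos
  linarith [h'.norm_estimate_sub_mul_le hm]

end IsTrace

/-- The parameters `a` of the traces whose nearest integers have code `e`. -/
def cell (T : TraceBounds) (P : ℂ[X]) (b : ℂ) {N : ℕ} (e : Fin N → ℤ) : Set ℂ :=
  {a | ∃ x, IsTrace T P b a x ∧ ∀ i : Fin N, code b P T.burnIn (fun n => round (x n)) i = e i}

theorem ediam_cell_le (T : TraceBounds) (P : ℂ[X]) (b : ℂ) {N : ℕ}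
    (hN : T.burnIn + 4 + P.natDegree ≤ N) (e : Fin N → ℤ) :
    Metric.ediam (cell T P b e) ≤ ENNReal.ofReal
      (4 * T.A * T.Q / T.c * T.ϑ ^ (4 + P.natDegree) * T.ϑ⁻¹ ^ N) := by
  refine Metric.ediam_le fun a ⟨x, hx, he⟩ a' ⟨x', hx', he'⟩ => ?_
  rw [edist_dist, dist_eq_norm]
  refine ENNReal.ofReal_le_ofReal ?_
  obtain ⟨m, rfl⟩ : ∃ m, N = m + (4 + P.natDegree) := ⟨N - (4 + P.natDegree), by omega⟩
  have hϑ : 0 < T.ϑ := one_pos.trans T.one_lt_ϑ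
  have hc := T.c_pos
  have hparam := hx.norm_param_sub_mul_le hx' (m := m) (by omega) fun n hn =>
    (he ⟨n, by omega⟩).trans (he' ⟨n, by omega⟩).symm
  calc ‖a - a'‖ ≤ 2 * (T.A * T.Q) / (T.c / 2 * T.ϑ ^ m) :=
        (le_div_iff₀ (by positivity)).2 hparam
    _ = _ := by rw [pow_add T.ϑ⁻¹, inv_pow, inv_pow]; field_simp; ring

theorem exists_dimH_le_of_frequently_sparse (T : TraceBounds) (d : ℕ) {β : ℝ} (hβ : 0 < β) :
    ∃ κ > 0, ∀ (P : ℂ[X]) (b : ℂ) (E : Set ℂ), P.natDegree = d →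
      (∀ a ∈ E, ∃ᶠ N : ℕ in atTop, ∃ x, IsTrace T P b a x ∧
        (#(farIndices T.threshold x N) : ℝ) ≤ κ * N) →
      dimH E ≤ ENNReal.ofReal β := by
  have hϑ := T.one_lt_ϑ
  have hϑ₀ : 0 < T.ϑ := one_pos.trans hϑ
  have hA := T.one_le_A
  have hQ := T.one_le_Q
  have hc := T.c_pos
  obtain ⟨κ, hκ, K, hcard⟩ := exists_card_sparseCodes_le_mul_pow (T.codeBound d)
    (T.burnIn + d + 4) (Real.one_lt_rpow hϑ (half_pos hβ))
  refine ⟨κ / (d + 5), by positivity, ?_⟩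
  rintro P b E rfl hE
  have hcover : ∀ a ∈ E, ∃ᶠ N in atTop,
      ∃ e : sparseCodes N (T.codeBound P.natDegree) (T.burnIn + P.natDegree + 4 + κ * N),
        a ∈ cell T P b e.1 := fun a ha => (hE a ha).mono fun N ⟨x, hx, hsparse⟩ => by
    have hmem := hx.code_mem_sparseCodes hsparse
    rw [← mul_assoc, mul_div_cancel₀ _ (by positivity)] at hmem
    exact ⟨⟨_, hmem⟩, x, hx, fun _ => rfl⟩
  refine dimH_limsup_le_of_geometric (μ := T.ϑ ^ (β / 2)) hcover hβ.le (by positivity)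
    (by positivity) (inv_pos.2 hϑ₀).le (inv_lt_one_of_one_lt₀ hϑ) ?_
    ((eventually_ge_atTop _).mono fun N hN e => ediam_cell_le T P b hN e.1)
    fun N => by simpa using hcard N
  rw [Real.inv_rpow hϑ₀.le, ← Real.rpow_neg hϑ₀.le, ← Real.rpow_add hϑ₀]
  exact Real.rpow_lt_one_of_one_lt_of_neg hϑ (by linarith)

/-! ### The traces attached to `H` -/

theorem sum_norm_coeff_le_two_pow_mul_mahlerMeasure (P : ℂ[X]) :
    ∑ i ∈ range (P.natDegree + 1), ‖P.coeff i‖ ≤ 2 ^ P.natDegree * P.mahlerMeasure := by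
  calc _ ≤ ∑ i ∈ range (P.natDegree + 1), (P.natDegree.choose i : ℝ) * P.mahlerMeasure :=
        sum_le_sum fun i _ => Polynomial.norm_coeff_le_choose_mul_mahlerMeasure i P
    _ = _ := by rw [← sum_mul]; norm_cast; rw [Nat.sum_range_choose]

section RootPoly

variable {ι : Type*} [Fintype ι]

/-- The monic polynomial with roots `v`. -/
def rootPoly {R : Type*} [CommRing R] (v : ι → R) : R[X] :=
  ∏ j, (Polynomial.X - Polynomial.C (v j))

theorem monic_rootPoly {R : Type*} [CommRing R] (v : ι → R) : (rootPoly v).Monic :=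
  Polynomial.monic_prod_X_sub_C _ _

theorem natDegree_rootPoly {R : Type*} [CommRing R] [Nontrivial R] (v : ι → R) :
    (rootPoly v).natDegree = Fintype.card ι := by
  rw [rootPoly, Polynomial.natDegree_finsetProd_X_sub_C_eq_card, Finset.card_univ]

theorem eval_rootPoly {R : Type*} [CommRing R] (v : ι → R) (w : R) :
    (rootPoly v).eval w = ∏ j, (w - v j) := by
  simp only [rootPoly, Polynomial.eval_prod, Polynomial.eval_sub, Polynomial.eval_X,
    Polynomial.eval_C]

theorem eval_rootPoly_self {R : Type*} [CommRing R] (v : ι → R) (j : ι) :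
    (rootPoly v).eval (v j) = 0 := by
  rw [eval_rootPoly]; exact prod_eq_zero (mem_univ j) (sub_self _)

theorem sum_norm_coeff_rootPoly_le {v : ι → ℂ} {r : ℝ} (hr : 1 ≤ r) (hv : ∀ j, ‖v j‖ ≤ r) :
    ∑ i ∈ range ((rootPoly v).natDegree + 1), ‖(rootPoly v).coeff i‖
      ≤ (2 * r) ^ Fintype.card ι := by
  have hmahler : (rootPoly v).mahlerMeasure ≤ r ^ Fintype.card ι := by
    have hprod : (rootPoly v).mahlerMeasure = ∏ j, max 1 ‖v j‖ := by
      rw [rootPoly, Finset.prod, Polynomial.prod_mahlerMeasure_eq_mahlerMeasure_prod,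
        Multiset.map_map]
      simp only [Function.comp_def, Polynomial.mahlerMeasure_X_sub_C, Finset.prod]
    rw [hprod, ← Finset.card_univ, ← prod_const]
    exact prod_le_prod (fun _ _ => by positivity) fun j _ => max_le hr (hv j)
  calc _ ≤ 2 ^ (rootPoly v).natDegree * (rootPoly v).mahlerMeasure :=
        sum_norm_coeff_le_two_pow_mul_mahlerMeasure _
    _ ≤ 2 ^ Fintype.card ι * r ^ Fintype.card ι := by rw [natDegree_rootPoly]; gcongr
    _ = _ := (mul_pow _ _ _).symm

theorem pow_card_le_norm_eval_rootPoly {K : Type*} [NormedField K] {v : ι → K} {w : K} {r : ℝ}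
    (hr : 0 ≤ r) (h : ∀ j, r ≤ ‖w - v j‖) : r ^ Fintype.card ι ≤ ‖(rootPoly v).eval w‖ := by
  rw [eval_rootPoly, norm_prod, ← Finset.card_univ, ← prod_const]
  exact prod_le_prod (fun _ _ => hr) fun j _ => h j

end RootPoly

theorem defect_pow_mul_add_pow_mul {R : Type*} [CommRing R] (u v α β : R) (n : ℕ) :
    defect (u + v) (u * v) (fun n => u ^ n * α + v ^ n * β) n = 0 := by
  simp only [defect]; ring

theorem norm_pow_mul_le_of_eq_add {K : Type*} [NormedField K] {u v α β : K} {y : ℕ → K}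
    (hy : ∀ n, y n = u ^ n * α + v ^ n * β) (n : ℕ) :
    ‖u‖ ^ n * ‖α‖ * ‖u - v‖ ≤ ‖v‖ * ‖y n‖ + ‖y (n + 1)‖ := by
  have helim : u ^ n * α * (u - v) = y (n + 1) - v * y n := by rw [hy, hy]; ring
  calc ‖u‖ ^ n * ‖α‖ * ‖u - v‖ = ‖y (n + 1) - v * y n‖ := by
        rw [← helim, norm_mul, norm_mul, norm_pow]
    _ ≤ ‖v‖ * ‖y n‖ + ‖y (n + 1)‖ := by
        rw [← norm_mul, add_comm ‖v * y n‖]; exact norm_sub_le (y (n + 1)) (v * y n)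

theorem eq_oddIdx_or_evenIdx {s : ℕ} (j : Fin (2 * s)) :
    (∃ k : Fin s, j = oddIdx k) ∨ ∃ k : Fin s, j = evenIdx k := by
  obtain ⟨j, hj⟩ := j
  rcases Nat.even_or_odd' j with ⟨k, rfl | rfl⟩
  · exact Or.inl ⟨⟨k, by omega⟩, rfl⟩
  · exact Or.inr ⟨⟨k, by omega⟩, rfl⟩

theorem oddIdx_ne_evenIdx {s : ℕ} (k l : Fin s) : oddIdx k ≠ evenIdx l := fun h => by
  have := congrArg Fin.val h
  simp only [oddIdx, evenIdx] at this
  omega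

section Trace

variable {s : ℕ} {ϑ b₁ b₂ : ℝ} {θ z : Fin (2 * s) → ℂ}

theorem norm_of_mem_H (hθ : θ ∈ H s ϑ b₁ b₂) (j : Fin (2 * s)) : ‖θ j‖ = ϑ := by
  rcases eq_oddIdx_or_evenIdx j with ⟨k, rfl⟩ | ⟨k, rfl⟩
  · exact (hθ.1 k).1
  · rw [(hθ.1 k).2.2, RCLike.norm_conj, (hθ.1 k).1]

theorem norm_tau (hθ : θ ∈ H s ϑ b₁ b₂) (j : Fin (2 * s)) :
    ‖tau ϑ θ z j‖ = (ϑ ^ scale ϑ z)⁻¹ * ‖z j‖ := by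
  rw [tau, norm_mul, norm_inv, norm_pow, norm_of_mem_H hθ]

theorem norm_lt_pow_scale_succ (hϑ : 1 < ϑ) (hz : 1 ≤ ‖z‖) : ‖z‖ < ϑ ^ (scale ϑ z + 1) := by
  have := (scale_spec hϑ z hz).2
  rwa [inv_mul_lt_iff₀ (by positivity), ← pow_succ] at this

/-- The sequence `n ↦ ∑ j, θ j ^ n * τ j` of the sums in `Psi`, which are real when `θ` and `z` are
paired by conjugation. -/
def traceSeq (ϑ : ℝ) (θ z : Fin (2 * s) → ℂ) (n : ℕ) : ℝ := (∑ j, θ j ^ n * tau ϑ θ z j).re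

theorem ofReal_traceSeq (hθ : θ ∈ H s ϑ b₁ b₂) (hz : ConjPaired z) (n : ℕ) :
    (traceSeq ϑ θ z n : ℂ) = ∑ j, θ j ^ n * tau ϑ θ z j :=
  Complex.ext rfl (sum_im_eq_zero ϑ θ z (fun j => (hθ.1 j).2.2) hz n).symm

theorem abs_traceSeq_le (hϑ : 1 < ϑ) (hθ : θ ∈ H s ϑ b₁ b₂) (hz : 1 ≤ ‖z‖) (n : ℕ) :
    |traceSeq ϑ θ z n| ≤ 2 * s * ϑ * ϑ ^ n := by
  have hterm : ∀ j, ‖θ j ^ n * tau ϑ θ z j‖ ≤ ϑ ^ n * ϑ := fun j => by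
    rw [norm_mul, norm_pow, norm_of_mem_H hθ, norm_tau hθ]
    gcongr
    calc _ ≤ (ϑ ^ scale ϑ z)⁻¹ * ‖z‖ := by gcongr; exact norm_le_pi_norm z j
      _ ≤ ϑ := (scale_spec hϑ z hz).2.le
  calc _ ≤ ∑ _j : Fin (2 * s), ϑ ^ n * ϑ :=
        (Complex.abs_re_le_norm _).trans (norm_sum_le_of_le _ fun j _ => hterm j)
    _ = 2 * s * ϑ * ϑ ^ n := by
        rw [sum_const, Finset.card_univ, Fintype.card_fin, nsmul_eq_mul]; push_cast; ring

/-- The positions of the fixed coordinates, i.e. all but `2ℓ-1` and `2ℓ`. -/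
abbrev FixedIdx (ℓ : Fin s) : Type := {j : Fin (2 * s) // j ≠ oddIdx ℓ ∧ j ≠ evenIdx ℓ}

/-- The elements of `H` with prescribed fixed coordinates. -/
def fiber (ϑ b₁ b₂ : ℝ) {ℓ : Fin s} (θ' : FixedIdx ℓ → ℂ) : Set (Fin (2 * s) → ℂ) :=
  {θ ∈ H s ϑ b₁ b₂ | ∀ j : FixedIdx ℓ, θ j.1 = θ' j}

/-- The vectors paired by conjugation, of norm at least `1`, that attain their sup-norm at the
coordinate `2ℓ-1`. -/
def dominantVectors (ℓ : Fin s) : Set (Fin (2 * s) → ℂ) :=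
  {z | ConjPaired z ∧ ‖z (oddIdx ℓ)‖ = ‖z‖ ∧ 1 ≤ ‖z‖}

variable {ℓ : Fin s} {θ' : FixedIdx ℓ → ℂ}

theorem shiftEval_traceSeq (hθ : θ ∈ fiber ϑ b₁ b₂ θ') (hz : ConjPaired z) (n : ℕ) :
    shiftEval (rootPoly θ') (fun n => traceSeq ϑ θ z n) n
      = θ (oddIdx ℓ) ^ n * (tau ϑ θ z (oddIdx ℓ) * (rootPoly θ').eval (θ (oddIdx ℓ)))
        + θ (evenIdx ℓ) ^ n * (tau ϑ θ z (evenIdx ℓ) * (rootPoly θ').eval (θ (evenIdx ℓ))) := by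
  simp only [ofReal_traceSeq hθ.1 hz]
  rw [shiftEval_sum_pow, Fintype.sum_eq_add (oddIdx ℓ) (evenIdx ℓ) (oddIdx_ne_evenIdx ℓ ℓ)]
  intro j hj
  rw [hθ.2 ⟨j, hj⟩, eval_rootPoly_self, mul_zero, mul_zero]

theorem pow_card_le_norm_amplitude (hϑ : 1 < ϑ) (hb₂ : 0 ≤ b₂) (hθ : θ ∈ fiber ϑ b₁ b₂ θ')
    (hz : z ∈ dominantVectors ℓ) :
    b₂ ^ Fintype.card (FixedIdx ℓ)
      ≤ ‖tau ϑ θ z (oddIdx ℓ) * (rootPoly θ').eval (θ (oddIdx ℓ))‖ := by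
  have hpoly : b₂ ^ Fintype.card (FixedIdx ℓ) ≤ ‖(rootPoly θ').eval (θ (oddIdx ℓ))‖ :=
    pow_card_le_norm_eval_rootPoly hb₂ fun j => by
      rw [← hθ.2]; exact hθ.1.2 _ _ j.2.1.symm
  rw [norm_mul, norm_tau hθ.1, hz.2.1]
  exact hpoly.trans (le_mul_of_one_le_left (norm_nonneg _) (scale_spec hϑ z hz.2.2).1)

theorem two_mul_le_norm_oddIdx_sub_evenIdx (hθ : θ ∈ H s ϑ b₁ b₂) (ℓ : Fin s) :
    2 * b₁ ≤ ‖θ (oddIdx ℓ) - θ (evenIdx ℓ)‖ := by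
  rw [(hθ.1 ℓ).2.2]
  calc 2 * b₁ ≤ (θ (oddIdx ℓ) - (starRingEnd ℂ) (θ (oddIdx ℓ))).im := by
        rw [Complex.sub_im, Complex.conj_im]; linarith [(hθ.1 ℓ).2.1]
    _ ≤ _ := (le_abs_self _).trans (Complex.abs_im_le_norm _)

theorem lower_shiftEval_traceSeq (hϑ : 1 < ϑ) (hb₁ : 0 ≤ b₁) (hb₂ : 0 ≤ b₂)
    (hθ : θ ∈ fiber ϑ b₁ b₂ θ') (hz : z ∈ dominantVectors ℓ) (n : ℕ) :
    2 * b₁ * b₂ ^ Fintype.card (FixedIdx ℓ) * ϑ ^ n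
      ≤ ‖shiftEval (rootPoly θ') (fun n => traceSeq ϑ θ z n) (n + 1)‖
        + ‖shiftEval (rootPoly θ') (fun n => traceSeq ϑ θ z n) (n + 2)‖ := by
  set y := shiftEval (rootPoly θ') (fun n => traceSeq ϑ θ z n)
  have hlower := norm_pow_mul_le_of_eq_add (shiftEval_traceSeq hθ hz.1) (n + 1)
  rw [norm_of_mem_H hθ.1, norm_of_mem_H hθ.1] at hlower
  refine le_of_mul_le_mul_left ?_ (one_pos.trans hϑ)
  calc _ = ϑ ^ (n + 1) * b₂ ^ Fintype.card (FixedIdx ℓ) * (2 * b₁) := by ring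
    _ ≤ ϑ * ‖y (n + 1)‖ + ‖y (n + 2)‖ := by
        refine hlower.trans' ?_
        gcongr
        · exact pow_card_le_norm_amplitude hϑ hb₂ hθ hz
        · exact two_mul_le_norm_oddIdx_sub_evenIdx hθ.1 ℓ
    _ ≤ ϑ * (‖y (n + 1)‖ + ‖y (n + 2)‖) := by
        rw [mul_add]; gcongr; exact le_mul_of_one_le_left (norm_nonneg _) hϑ.le

/-- The constants for the traces attached to `H`, with `d` fixed coordinates. -/
def traceBounds (s d : ℕ) (hϑ : 1 < ϑ) (hb₁ : 0 < b₁) (hb₂ : 0 < b₂) : TraceBounds where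
  ϑ := ϑ
  A := (1 + ϑ) ^ 2
  Q := (2 * ϑ) ^ d
  c := 2 * b₁ * b₂ ^ d
  D := 2 * s * ϑ
  one_lt_ϑ := hϑ
  one_le_A := one_le_pow₀ (by linarith)
  one_le_Q := one_le_pow₀ (by linarith)
  c_pos := by positivity
  D_nonneg := by positivity

theorem isTrace_traceSeq (hϑ : 1 < ϑ) (hb₁ : 0 < b₁) (hb₂ : 0 < b₂)
    (hθ : θ ∈ fiber ϑ b₁ b₂ θ') (hz : z ∈ dominantVectors ℓ) :
    IsTrace (traceBounds s (Fintype.card (FixedIdx ℓ)) hϑ hb₁ hb₂) (rootPoly θ') (ϑ ^ 2)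
      (2 * (θ (oddIdx ℓ)).re : ℝ) (traceSeq ϑ θ z) := by
  have hconj : θ (evenIdx ℓ) = (starRingEnd ℂ) (θ (oddIdx ℓ)) := (hθ.1.1 ℓ).2.2
  have hsum : ((2 * (θ (oddIdx ℓ)).re : ℝ) : ℂ) = θ (oddIdx ℓ) + θ (evenIdx ℓ) := by
    rw [hconj, Complex.add_conj]
  have hprod : (ϑ : ℂ) ^ 2 = θ (oddIdx ℓ) * θ (evenIdx ℓ) := by
    rw [hconj, Complex.mul_conj', norm_of_mem_H hθ.1]
  refine ⟨monic_rootPoly _, sum_norm_coeff_rootPoly_le hϑ.le fun j => ?_, ?_, fun n => ?_,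
    lower_shiftEval_traceSeq hϑ hb₁.le hb₂.le hθ hz, abs_traceSeq_le hϑ hθ.1 hz.2.2⟩
  · rw [← hθ.2, norm_of_mem_H hθ.1]
  · calc _ ≤ 1 + (ϑ + ϑ) + ϑ * ϑ := by
          rw [hsum, hprod, norm_mul, norm_of_mem_H hθ.1, norm_of_mem_H hθ.1]
          gcongr
          exact norm_add_le_of_le (norm_of_mem_H hθ.1 _).le (norm_of_mem_H hθ.1 _).le
      _ = (1 + ϑ) ^ 2 := by ring
  · rw [hsum, hprod, funext (shiftEval_traceSeq hθ hz.1)]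
    exact defect_pow_mul_add_pow_mul _ _ _ _ n

end Trace

theorem norm_sub_le_mul_abs_re_sub {w w' : ℂ} {r b : ℝ} (hb : 0 < b) (hw : ‖w‖ = r)
    (hw' : ‖w'‖ = r) (him : b ≤ w.im) (him' : b ≤ w'.im) :
    ‖w - w'‖ ≤ (1 + r / b) * |w.re - w'.re| := by
  have hcircle : (w.im - w'.im) * (w.im + w'.im) = -((w.re - w'.re) * (w.re + w'.re)) := by
    have hsq := Complex.sq_norm w
    have hsq' := Complex.sq_norm w'
    rw [hw, Complex.normSq_apply] at hsq
    rw [hw', Complex.normSq_apply] at hsq'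
    linarith
  have hmul : |w.im - w'.im| * (2 * b) ≤ |w.re - w'.re| * (2 * r) :=
    calc _ ≤ |w.im - w'.im| * |w.im + w'.im| := by
          gcongr; exact le_trans (by linarith) (le_abs_self _)
      _ = |w.re - w'.re| * |w.re + w'.re| := by rw [← abs_mul, hcircle, abs_neg, abs_mul]
      _ ≤ _ := by
          gcongr
          linarith [abs_add_le w.re w'.re, Complex.abs_re_le_norm w, Complex.abs_re_le_norm w']
  have him_le : |w.im - w'.im| ≤ r / b * |w.re - w'.re| := by
    rw [div_mul_eq_mul_div, le_div_iff₀ hb]; linarith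
  have hnorm := Complex.norm_le_abs_re_add_abs_im (w - w')
  rw [Complex.sub_re, Complex.sub_im] at hnorm
  linarith

/-! ### The exceptional set -/

section Exceptional

variable {s : ℕ} {ϑ b₁ b₂ ρ κ : ℝ} {ℓ : Fin s} {θ' : FixedIdx ℓ → ℂ} {θ : Fin (2 * s) → ℂ}

/-- The exceptional set: the values of the free coordinate for which, at infinitely many scales,
the trace of some `z` is within `ρ` of the integers at all but a proportion `κ` of the indices. -/
def exceptionalSet (ϑ b₁ b₂ : ℝ) (θ' : FixedIdx ℓ → ℂ) (ρ κ : ℝ) : Set ℂ :=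
  {w ∈ halfCircle ϑ | ∃ θ ∈ fiber ϑ b₁ b₂ θ', θ (oddIdx ℓ) = w ∧ ∃ᶠ N : ℕ in atTop,
    ∃ z ∈ dominantVectors ℓ, scale ϑ z + 1 = N ∧
      (#(farIndices ρ (traceSeq ϑ θ z) N) : ℝ) ≤ κ * N}

theorem exists_dimH_exceptionalSet_le (ℓ : Fin s) (hϑ : 1 < ϑ) (hb₁ : 0 < b₁) (hb₂ : 0 < b₂)
    {β : ℝ} (hβ : 0 < β) :
    ∃ ρ > 0, ∃ κ > 0, ∀ θ' : FixedIdx ℓ → ℂ,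
      dimH (exceptionalSet ϑ b₁ b₂ θ' ρ κ) ≤ ENNReal.ofReal β := by
  let T := traceBounds s (Fintype.card (FixedIdx ℓ)) hϑ hb₁ hb₂
  obtain ⟨κ, hκ, hdim⟩ := exists_dimH_le_of_frequently_sparse T (Fintype.card (FixedIdx ℓ)) hβ
  refine ⟨T.threshold, T.threshold_pos, κ, hκ, fun θ' => ?_⟩
  let param : ℂ → ℂ := fun w => (2 * w.re : ℝ)
  let K : ℝ≥0 := (1 + ϑ / b₁).toNNReal
  have hparam : ∀ w ∈ exceptionalSet ϑ b₁ b₂ θ' T.threshold κ,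
      ∀ w' ∈ exceptionalSet ϑ b₁ b₂ θ' T.threshold κ,
        edist w w' ≤ K * edist (param w) (param w') := by
    rintro _ ⟨-, θ, hθ, rfl, -⟩ _ ⟨-, θ₁, hθ₁, rfl, -⟩
    have hre : |(θ (oddIdx ℓ)).re - (θ₁ (oddIdx ℓ)).re|
        ≤ dist (param (θ (oddIdx ℓ))) (param (θ₁ (oddIdx ℓ))) := by
      rw [dist_eq_norm, ← Complex.ofReal_sub, Complex.norm_real, Real.norm_eq_abs, ← mul_sub,
        abs_mul, abs_two]
      linarith [abs_nonneg ((θ (oddIdx ℓ)).re - (θ₁ (oddIdx ℓ)).re)]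
    have hK : 0 ≤ 1 + ϑ / b₁ := by positivity
    rw [edist_dist, edist_dist, ← ENNReal.ofReal_coe_nnreal, ← ENNReal.ofReal_mul K.coe_nonneg,
      Real.coe_toNNReal _ hK, dist_eq_norm]
    refine ENNReal.ofReal_le_ofReal ((norm_sub_le_mul_abs_re_sub hb₁ (norm_of_mem_H hθ.1 _)
      (norm_of_mem_H hθ₁.1 _) (hθ.1.1 ℓ).2.1 (hθ₁.1.1 ℓ).2.1).trans ?_)
    gcongr
  refine (dimH_le_dimH_image_of_edist_le hparam).trans
    (hdim (rootPoly θ') (ϑ ^ 2) _ (natDegree_rootPoly θ') ?_)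
  rintro _ ⟨_, ⟨-, θ, hθ, rfl, hsparse⟩, rfl⟩
  exact hsparse.mono fun N ⟨z, hz, _, hfar⟩ => ⟨_, isTrace_traceSeq hϑ hb₁ hb₂ hθ hz, hfar⟩

theorem exists_forall_lt_card_farIndices (hϑ : 1 < ϑ) (hθ : θ ∈ fiber ϑ b₁ b₂ θ')
    (hmem : θ (oddIdx ℓ) ∈ halfCircle ϑ \ exceptionalSet ϑ b₁ b₂ θ' ρ κ) :
    ∃ R : ℝ, 1 ≤ R ∧ ∀ z : Fin (2 * s) → ℂ, ConjPaired z → ‖z (oddIdx ℓ)‖ = ‖z‖ → R ≤ ‖z‖ →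
      κ * (scale ϑ z + 1 : ℕ) < #(farIndices ρ (traceSeq ϑ θ z) (scale ϑ z + 1)) := by
  have hfinite := fun hfreq => hmem.2 ⟨hmem.1, θ, hθ, rfl, hfreq⟩
  obtain ⟨k, hk⟩ := eventually_atTop.1 (not_frequently.1 hfinite)
  refine ⟨ϑ ^ k, one_le_pow₀ hϑ.le, fun z hz hdom hR => ?_⟩
  have hz_one : 1 ≤ ‖z‖ := (one_le_pow₀ hϑ.le).trans hR
  have hscale : k ≤ scale ϑ z + 1 :=
    ((pow_lt_pow_iff_right₀ hϑ).1 (hR.trans_lt (norm_lt_pow_scale_succ hϑ hz_one))).le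
  exact not_le.1 fun hfar => hk _ hscale ⟨z, ⟨hz, hdom, hz_one⟩, rfl, hfar⟩

end Exceptional

/-! ### Decay of `Psi` -/

theorem abs_one_sub_le_exp {ε ρ δ : ℝ} (hε : 0 ≤ ε) (hε₁ : ε ≤ 1) (hρ : 0 ≤ ρ) (hδ : ρ ≤ δ)
    (hδ₁ : δ ≤ 1 / 2) :
    |1 - 2 * Real.pi * ε * δ ^ 2| ≤ Real.exp (-(Real.pi * ε * ρ ^ 2 / 2)) := by
  -- `|1 - t| ≤ 1 - t / 4` for `0 ≤ t ≤ 8 / 5`, and `t = 2 * π * ε * δ ^ 2` is at most `π / 2`.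
  have hδ_sq : δ ^ 2 ≤ 1 / 4 := by nlinarith
  have hεδ : ε * δ ^ 2 ≤ 1 / 4 :=
    (mul_le_of_le_one_left (sq_nonneg δ) hε₁).trans hδ_sq
  have hupper : Real.pi * (ε * δ ^ 2) ≤ 3.15 * (1 / 4) :=
    mul_le_mul Real.pi_lt_d2.le hεδ (by positivity) (by norm_num)
  have hlower : Real.pi * (ε * ρ ^ 2) ≤ Real.pi * (ε * δ ^ 2) := by gcongr
  have hρ_sq : 0 ≤ Real.pi * (ε * ρ ^ 2) := by positivity
  refine le_trans ?_ (Real.add_one_le_exp _)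
  rw [abs_le]
  constructor <;> linarith

section Decay

variable {s : ℕ} {ϑ ε ρ κ : ℝ}

theorem Psi_le_exp (θ z : Fin (2 * s) → ℂ) (hε : 0 ≤ ε) (hε₁ : ε ≤ 1) (hρ : 0 ≤ ρ) :
    Psi ϑ θ ε z ≤ Real.exp
      (-(Real.pi * ε * ρ ^ 2 / 2) * #(farIndices ρ (traceSeq ϑ θ z) (scale ϑ z + 1))) := by
  refine (le_abs_self _).trans ?_
  rw [Psi, abs_prod, mul_comm (-_), Real.exp_nat_mul, ← prod_const, farIndices, prod_filter]
  refine prod_le_prod (fun _ _ => abs_nonneg _) fun n _ => ?_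
  split_ifs with h
  · exact abs_one_sub_le_exp hε hε₁ hρ h.le (distInt_le_half _)
  · refine (abs_one_sub_le_exp hε hε₁ le_rfl (distInt_nonneg _) (distInt_le_half _)).trans ?_
    simp

theorem Psi_le_rpow {θ z : Fin (2 * s) → ℂ} (hϑ : 1 < ϑ) (hε : 0 ≤ ε) (hε₁ : ε ≤ 1) (hρ : 0 ≤ ρ)
    (hκ : 0 ≤ κ) (hz : 1 ≤ ‖z‖)
    (hfar : κ * (scale ϑ z + 1 : ℕ) ≤ #(farIndices ρ (traceSeq ϑ θ z) (scale ϑ z + 1))) :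
    Psi ϑ θ ε z ≤ ‖z‖ ^ (-(Real.pi * ε * ρ ^ 2 / 2 * κ / Real.log ϑ)) := by
  have hlog : 0 < Real.log ϑ := Real.log_pos hϑ
  have hz₀ : 0 < ‖z‖ := one_pos.trans_le hz
  have hlogz : Real.log ‖z‖ ≤ (scale ϑ z + 1 : ℕ) * Real.log ϑ := by
    rw [← Real.log_pow]
    exact Real.log_le_log hz₀ (norm_lt_pow_scale_succ hϑ hz).le
  refine (Psi_le_exp θ z hε hε₁ hρ).trans ?_
  rw [Real.rpow_def_of_pos hz₀, Real.exp_le_exp, mul_neg, neg_mul, neg_le_neg_iff]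
  calc _ ≤ (scale ϑ z + 1 : ℕ) * Real.log ϑ * (Real.pi * ε * ρ ^ 2 / 2 * κ / Real.log ϑ) := by
        gcongr
    _ = Real.pi * ε * ρ ^ 2 / 2 * (κ * (scale ϑ z + 1 : ℕ)) := by field_simp
    _ ≤ _ := by gcongr

end Decay

end FourierDecay

end

open FourierDecay in
theorem mainTheorem3_general {s : ℕ} (ℓ : Fin s) {ϑ b₁ b₂ β ε : ℝ} (hϑ : 1 < ϑ) (hb₁ : 0 < b₁)
    (hb₂ : 0 < b₂) (hβ : 0 < β) (hε : 0 < ε) (hε₁ : ε ≤ 1) :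
    ∃ γ : ℝ, 0 < γ ∧ ∀ θ' : FixedIdx ℓ → ℂ, ∃ E ⊆ halfCircle ϑ, dimH E ≤ ENNReal.ofReal β ∧
      ∀ θ ∈ H s ϑ b₁ b₂, (∀ j, θ j.1 = θ' j) → θ (oddIdx ℓ) ∈ halfCircle ϑ \ E →
        ∃ R : ℝ, 1 ≤ R ∧ ∀ z : Fin (2 * s) → ℂ, ConjPaired z → ‖z (oddIdx ℓ)‖ = ‖z‖ → R ≤ ‖z‖ →
          Psi ϑ θ ε z ≤ ‖z‖ ^ (-γ) := by
  obtain ⟨ρ, hρ, κ, hκ, hdim⟩ := exists_dimH_exceptionalSet_le ℓ hϑ hb₁ hb₂ hβ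
  have hlog : 0 < Real.log ϑ := Real.log_pos hϑ
  refine ⟨Real.pi * ε * ρ ^ 2 / 2 * κ / Real.log ϑ, by positivity, fun θ' =>
    ⟨exceptionalSet ϑ b₁ b₂ θ' ρ κ, fun _ hw => hw.1, hdim θ', fun θ hθ hfixed hmem => ?_⟩⟩
  obtain ⟨R, hR, hfar⟩ := exists_forall_lt_card_farIndices hϑ ⟨hθ, hfixed⟩ hmem
  exact ⟨R, hR, fun z hz hdom hRz =>
    Psi_le_rpow hϑ hε.le hε₁ hρ.le hκ.le (hR.trans hRz) (hfar z hz hdom hRz).le⟩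

theorem mainTheorem3 (s : ℕ) (hs : 2 ≤ s) (ϑ b₁ b₂ : ℝ) (hϑ : 1 < ϑ) (hb₁ : 0 < b₁)
    (hb₂ : 0 < b₂) :
    -- `C` is the constant `O_H(1)`; the exponent `γ` depends only on `H`, `ℓ`, `β`, `ε`
    ∃ C : ℝ, 0 < C ∧ ∀ (ℓ : Fin s) (β ε : ℝ), 0 < β → 0 < ε →
      ∃ γ : ℝ, 0 < γ ∧
        -- the fixed eigenvalues, compatible with membership in `H`
        ∀ θ' : {j : Fin (2 * s) // j ≠ FourierDecay.oddIdx ℓ ∧ j ≠ FourierDecay.evenIdx ℓ} → ℂ,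
          (∃ θ ∈ FourierDecay.H s ϑ b₁ b₂, ∀ j, θ j.1 = θ' j) →
          ∃ E : Set ℂ, E ⊆ FourierDecay.halfCircle ϑ ∧ dimH E ≤ ENNReal.ofReal β ∧
            ∀ θ ∈ FourierDecay.H s ϑ b₁ b₂, (∀ j, θ j.1 = θ' j) →
              θ (FourierDecay.oddIdx ℓ) ∈ FourierDecay.halfCircle ϑ \ E →
              -- `R` is the threshold `O_θ(1)`
              ∃ R : ℝ, 1 ≤ R ∧ ∀ (m : ℕ) (p : Fin (m + 1) → ℝ), p ∈ stdSimplex ℝ (Fin (m + 1)) →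
                (∀ i, ε ≤ p i) →
                ∀ z : Fin (2 * s) → ℂ, FourierDecay.ConjPaired z →
                  ‖z (FourierDecay.oddIdx ℓ)‖ = ‖z‖ → R ≤ ‖z‖ →
                  FourierDecay.Psi ϑ θ ε z ≤ C * ‖z‖ ^ (-γ) := by
  refine ⟨1, one_pos, fun ℓ β ε hβ hε => ?_⟩
  obtain ⟨γ, hγ, hdecay⟩ :=
    mainTheorem3_general ℓ hϑ hb₁ hb₂ hβ (lt_min hε one_pos) (min_le_right ε 1)
  refine ⟨γ, hγ, fun θ' _ => ?_⟩
  obtain ⟨E, hE, hdim, hexists⟩ := hdecay θ'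
  refine ⟨E, hE, hdim, fun θ hθ hfixed hmem => ?_⟩
  obtain ⟨R, hR, hPsi⟩ := hexists θ hθ hfixed hmem
  refine ⟨R, hR, fun m p hp hεp z hz hdom hRz => ?_⟩
  have hε₁ : ε ≤ 1 := (hεp 0).trans (mem_Icc_of_mem_stdSimplex hp 0).2
  simpa only [min_eq_left hε₁, one_mul] using hPsi z hz hdom hRz
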